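/- Conventions. All Hilbert spaces are finite dimensional and complex. Let $\beta_1,\dots,\beta_n\in\mathbb R$. A \emph{thermal repeated interaction model with $n$ baths at inverse temperatures $\beta_1,\dots,\beta_n$} consists of nonzero Hilbert spaces $\mathcal H_S,\mathcal H_{B_1},\dots,\mathcal H_{B_n}$, self-adjoint operators $H_S,K_S$ on $\mathcal H_S$, $K_{B_i}$ on $\mathcal H_{B_i}$ and $H_{SB_i}$ on $\mathcal H_S\otimes\mathcal H_{B_i}$ with $$[H_S,K_S]=0,\qquad [H_{SB_i},\,K_S\otimes 1+1\otimes K_{B_i}]=0\quad(1\le i\le n),$$ such that, with $\rho_{B_i}=e^{-\beta_iK_{B_i}}/\mathrm{Tr}(e^{-\beta_iK_{B_i}})$, $\mathcal H_B=\bigotimes_i\mathcal H_{B_i}$, $\rho_B=\bigotimes_i\rho_{B_i}$ and $H_{SB}=\sum_iH_{SB_i}$ on $\mathcal H_S\otimes\mathcal H_B$ (each $H_{SB_i}$ acting as the identity on the other baths), one has $\mathrm{Tr}_B\big(H_{SB}(1\otimes\rho_B)\big)=0$. Its Lindbladian is $$\mathcal L(A)=i[H_S,A]+\Phi(A)-\tfrac12\{\Phi(1),A\},\qquad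 \Phi(A)=\mathrm{Tr}_B\big(H_{SB}(A\otimes 1)H_{SB}(1\otimes\rho_B)\big),$$ and the energy flux into the $i$-th bath in the state $\rho$ is $$J_i(\rho)=-\mathrm{Tr}\big(\rho\,\mathcal L_i(K_S)\big),\qquad \mathcal L_i(A)=\Phi_i(A)-\tfrac12\{\Phi_i(1),A\},\qquad \Phi_i(A)=\mathrm{Tr}_{B_i}\big(H_{SB_i}(A\otimes 1)H_{SB_i}(1\otimes\rho_{B_i})\big).$$ A stationary state is a positive semidefinite $\rho$ with $\mathrm{Tr}\,\rho=1$ and $\mathcal L^*(\rho)=0$, where $\mathcal L^*$ is the dual of $\mathcal L$ for the pairing $(\rho,A)\mapsto\mathrm{Tr}(\rho A)$. \textbf{Proposition.} Let $J_1,\dots,J_n\in\mathbb R$ satisfy $\sum_{i=1}^nJ_i=0$ and $\sum_{i=1}^n\beta_iJ_i>0$. Then there exists a thermal repeated interaction model with $n$ baths at inverse temperatures $\beta_1,\dots,\beta_n$ such that: \begin{itemize} \item for every $i$ there is an orthonormal basis $(|j\rangle)_j$ of $\mathcal H_{B_i}$ in which $K_{B_i}$ is diagonal and $\langle j|H_{SB_i}|j\rangle=0$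 (as an operator on $\mathcal H_S$) for all $j$; \item $\mathcal L$ is positivity improving: for every nonzero $A\ge0$ and every $t>0$ the operator $e^{t\mathcal L}(A)$ is positive definite; moreover $\mathcal L$ is primitive, that is, $0$ is a simple eigenvalue of $\mathcal L$ and its only eigenvalue with real part zero; \item there is exactly one stationary state $\rho_\infty$, it is positive definite, and $J_i(\rho_\infty)=J_i$ for all $i\in\{1,\dots,n\}$. \end{itemize} -/

import Mathlib

open scoped ComplexOrder

namespace QuantumThermal

open Matrix
open scoped Kronecker

noncomputable section

/-- The partial trace over the second tensor factor,
`Tr_B : B(H_S ⊗ H_B) → B(H_S)`, where `H_S = ℂ^S` and `H_B = ℂ^B`. -/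
def partialTrace {S B : Type} [Fintype B] :
    Matrix (S × B) (S × B) ℂ →ₗ[ℂ] Matrix S S ℂ where
  toFun M := Matrix.of fun s s' => ∑ x, M (s, x) (s', x)
  map_add' M N := by
    ext s s'
    simp [Finset.sum_add_distrib]
  map_smul' c M := by
    ext s s'
    simp [Finset.mul_sum]

/-- A state (density matrix): positive semidefinite with trace one. -/
def IsState {S : Type} [Fintype S] (ρ : Matrix S S ℂ) : Prop :=
  ρ.PosSemidef ∧ ρ.trace = 1

/-- The Gibbs state `e^{-β K} / Tr e^{-β K}`. -/
def gibbs {B : Type} [Fintype B] [DecidableEq B] (β : ℝ) (K : Matrix B B ℂ) : Matrix B B ℂ :=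
  (NormedSpace.exp (-(β : ℂ) • K)).trace⁻¹ • NormedSpace.exp (-(β : ℂ) • K)

/-- The completely positive map `Φ(A) = Tr_B (H (A ⊗ 1) H (1 ⊗ ρ))` in the Heisenberg picture;
its dual is `Φ^*(ρ_S) = Tr_B (H (ρ_S ⊗ ρ) H)`. -/
def interactionMap {S B : Type} [Fintype S] [DecidableEq S] [Fintype B] [DecidableEq B]
    (H : Matrix (S × B) (S × B) ℂ) (ρ : Matrix B B ℂ) :
    Matrix S S ℂ →ₗ[ℂ] Matrix S S ℂ where
  toFun A := partialTrace (H * (A ⊗ₖ (1 : Matrix B B ℂ)) * H * ((1 : Matrix S S ℂ) ⊗ₖ ρ))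
  map_add' A A' := by
    rw [Matrix.add_kronecker, Matrix.mul_add, Matrix.add_mul, Matrix.add_mul, map_add]
  map_smul' c A := by
    rw [Matrix.smul_kronecker, Matrix.mul_smul, Matrix.smul_mul, Matrix.smul_mul, map_smul,
      RingHom.id_apply]

/-- The dissipative part `A ↦ Φ(A) - ½ {Φ(1), A}`. -/
def dissipator {S : Type} [Fintype S] [DecidableEq S]
    (Φ : Matrix S S ℂ →ₗ[ℂ] Matrix S S ℂ) : Matrix S S ℂ →ₗ[ℂ] Matrix S S ℂ :=
  Φ - (1 / 2 : ℂ) • (LinearMap.mulLeft ℂ (Φ 1) + LinearMap.mulRight ℂ (Φ 1))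

/-- The Lindbladian `A ↦ i [H_S, A] + Φ(A) - ½ {Φ(1), A}` (Heisenberg picture). -/
def lindblad {S : Type} [Fintype S] [DecidableEq S] (HS : Matrix S S ℂ)
    (Φ : Matrix S S ℂ →ₗ[ℂ] Matrix S S ℂ) : Matrix S S ℂ →ₗ[ℂ] Matrix S S ℂ :=
  Complex.I • (LinearMap.mulLeft ℂ HS - LinearMap.mulRight ℂ HS) + dissipator Φ

/-- The tensor product `⊗_i M_i` of operators on the factors of `⊗_i ℂ^{B_i}`. -/
def tensorProd {ι : Type} [Fintype ι] {B : ι → Type} (M : ∀ i, Matrix (B i) (B i) ℂ) :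
    Matrix (∀ i, B i) (∀ i, B i) ℂ :=
  Matrix.of fun x y => ∏ i, M i (x i) (y i)

/-- An operator on `H_S ⊗ H_{B_i}` seen as an operator on `H_S ⊗ (⊗_j H_{B_j})`, acting as the
identity on the factors `j ≠ i`. -/
def extend {S : Type} {ι : Type} {B : ι → Type} (i : ι)
    (H : Matrix (S × B i) (S × B i) ℂ) :
    Matrix (S × (∀ j, B j)) (S × (∀ j, B j)) ℂ :=
  open Classical in
  Matrix.of fun p q => if ∀ j, j ≠ i → p.2 j = q.2 j then H (p.1, p.2 i) (q.1, q.2 i) else 0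

/-- A thermal repeated interaction model with `n` baths at inverse temperatures `β i`.
The system is `H_S = ℂ^S`, the bath is `H_B = ⊗_i ℂ^{B i}` in the product of the Gibbs states
of the `K_B i`. -/
structure ThermalModel {n : ℕ} (β : Fin n → ℝ) where
  /-- index set of an orthonormal basis of the system -/
  S : Type
  /-- index set of an orthonormal basis of the `i`-th bath -/
  B : Fin n → Type
  fintypeS : Fintype S
  decEqS : DecidableEq S
  nonemptyS : Nonempty S
  fintypeB : ∀ i, Fintype (B i)
  decEqB : ∀ i, DecidableEq (B i)
  nonemptyB : ∀ i, Nonempty (B i)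
  /-- the Hamiltonian of the system -/
  HS : Matrix S S ℂ
  /-- the pseudo-energy of the system -/
  KS : Matrix S S ℂ
  /-- the energy operators of the baths -/
  KB : ∀ i, Matrix (B i) (B i) ℂ
  /-- the interactions of the system with the individual baths -/
  HSB : ∀ i, Matrix (S × B i) (S × B i) ℂ
  HS_herm : HS.IsHermitian
  KS_herm : KS.IsHermitian
  KB_herm : ∀ i, (KB i).IsHermitian
  HSB_herm : ∀ i, (HSB i).IsHermitian
  /-- `[H_S, K_S] = 0` -/
  HS_comm : Commute HS KS
  /-- `[H_{SB_i}, K_S ⊗ 1 + 1 ⊗ K_{B_i}] = 0` -/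
  HSB_comm : ∀ i, Commute (HSB i)
    (KS ⊗ₖ (1 : Matrix (B i) (B i) ℂ) + (1 : Matrix S S ℂ) ⊗ₖ KB i)
  /-- `Tr_B (H_SB (1 ⊗ ρ_B)) = 0`, the condition under which the continuous-time limit of the
  repeated interactions exists -/
  centered : partialTrace ((∑ i, extend i (HSB i)) *
    ((1 : Matrix S S ℂ) ⊗ₖ tensorProd fun i => gibbs (β i) (KB i))) = 0

attribute [instance] ThermalModel.fintypeS ThermalModel.decEqS ThermalModel.nonemptyS
  ThermalModel.fintypeB ThermalModel.decEqB ThermalModel.nonemptyB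

namespace ThermalModel

variable {n : ℕ} {β : Fin n → ℝ} (M : ThermalModel β)

/-- The state `ρ_{B_i}` of the `i`-th bath. -/
def bathState (i : Fin n) : Matrix (M.B i) (M.B i) ℂ := gibbs (β i) (M.KB i)

/-- The state `ρ_B = ⊗_i ρ_{B_i}` of the whole bath. -/
def fullBathState : Matrix (∀ i, M.B i) (∀ i, M.B i) ℂ := tensorProd M.bathState

/-- The full interaction `H_SB = ∑_i H_{SB_i}` on `H_S ⊗ H_B`. -/
def fullInteraction : Matrix (M.S × (∀ i, M.B i)) (M.S × (∀ i, M.B i)) ℂ :=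
  ∑ i, extend i (M.HSB i)

/-- The complete Lindbladian `L` of the model. -/
def lindbladian : Matrix M.S M.S ℂ →ₗ[ℂ] Matrix M.S M.S ℂ :=
  lindblad M.HS (interactionMap M.fullInteraction M.fullBathState)

/-- The dissipative part `L_i` of the Lindbladian which is due to the `i`-th bath. -/
def bathLindbladian (i : Fin n) : Matrix M.S M.S ℂ →ₗ[ℂ] Matrix M.S M.S ℂ :=
  dissipator (interactionMap (M.HSB i) (M.bathState i))

/-- The flux `J_i(ρ) = - Tr (ρ L_i(K_S))` of energy entering the `i`-th bath. -/
def flux (i : Fin n) (ρ : Matrix M.S M.S ℂ) : ℂ :=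
  -(ρ * M.bathLindbladian i M.KS).trace

/-- For each bath there is an orthonormal basis `|j⟩` (the columns of the unitary matrix `U`) in
which `K_{B_i}` is diagonal and such that `⟨j| H_{SB_i} |j⟩ = 0` as an operator on `H_S`. -/
def HasZeroDiagonal : Prop :=
  ∀ i, ∃ U ∈ Matrix.unitaryGroup (M.B i) ℂ, (Uᴴ * M.KB i * U).IsDiag ∧
    ∀ (j : M.B i) (s s' : M.S),
      (((1 : Matrix M.S M.S ℂ) ⊗ₖ Uᴴ) * M.HSB i * ((1 : Matrix M.S M.S ℂ) ⊗ₖ U))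
        (s, j) (s', j) = 0

end ThermalModel

/-- The semigroup `e^{tL}` applied to `A`, as a convergent power series. -/
def semigroup {S : Type} (L : Matrix S S ℂ →ₗ[ℂ] Matrix S S ℂ) (t : ℝ)
    (A : Matrix S S ℂ) : Matrix S S ℂ :=
  ∑' k : ℕ, ((t : ℂ) ^ k / (k.factorial : ℂ)) • (L ^ k) A

theorem summable_exp_series {E : Type} [NormedAddCommGroup E] [NormedSpace ℂ E]
    [FiniteDimensional ℂ E] (L : E →ₗ[ℂ] E) (t : ℝ) (A : E) :
    Summable (fun k : ℕ => ((t : ℂ) ^ k / (k.factorial : ℂ)) • (L ^ k) A) := by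
  have h1 : ∀ k : ℕ, ‖(L ^ k) A‖ ≤ ‖LinearMap.toContinuousLinearMap L‖ ^ k * ‖A‖ := by
    intro k
    induction k with
    | zero => simp
    | succ k ih =>
      rw [pow_succ', pow_succ', Module.End.mul_apply]
      calc ‖L ((L ^ k) A)‖ ≤ ‖LinearMap.toContinuousLinearMap L‖ * ‖(L ^ k) A‖ :=
            (LinearMap.toContinuousLinearMap L).le_opNorm _
        _ ≤ ‖LinearMap.toContinuousLinearMap L‖ *
            (‖LinearMap.toContinuousLinearMap L‖ ^ k * ‖A‖) := by gcongr
        _ = _ := by ring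
  have hs := Real.summable_pow_div_factorial (|t| * ‖LinearMap.toContinuousLinearMap L‖)
  refine Summable.of_norm_bounded (hs.mul_right ‖A‖) ?_
  intro k
  rw [norm_smul, norm_div, norm_pow, Complex.norm_real, Complex.norm_natCast,
    Real.norm_eq_abs, mul_pow]
  calc |t| ^ k / (k.factorial : ℝ) * ‖(L ^ k) A‖
      ≤ |t| ^ k / (k.factorial : ℝ) * (‖LinearMap.toContinuousLinearMap L‖ ^ k * ‖A‖) := by
        gcongr
        exact h1 k
    _ = _ := by ring

/-- The series that defines `semigroup` converges for every superoperator. -/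
theorem hasSum_semigroup {S : Type} [Fintype S]
    (L : Matrix S S ℂ →ₗ[ℂ] Matrix S S ℂ) (t : ℝ) (A : Matrix S S ℂ) :
    HasSum (fun k : ℕ => ((t : ℂ) ^ k / (k.factorial : ℂ)) • (L ^ k) A) (semigroup L t A) := by
  have h : Summable (fun k : ℕ => ((t : ℂ) ^ k / (k.factorial : ℂ)) • (L ^ k) A) :=
    @summable_exp_series (Matrix S S ℂ) Matrix.normedAddCommGroup Matrix.normedSpace
      inferInstance L t A
  exact h.hasSum

/-- `e^{tL}` maps every nonzero positive semidefinite operator to a positive definite one, for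
all `t > 0`. -/
def IsPositivityImproving {S : Type} [Fintype S]
    (L : Matrix S S ℂ →ₗ[ℂ] Matrix S S ℂ) : Prop :=
  ∀ t : ℝ, 0 < t → ∀ A : Matrix S S ℂ, A.PosSemidef → A ≠ 0 → (semigroup L t A).PosDef

/-- `0` is a simple eigenvalue of `L` (algebraic multiplicity one) and its only eigenvalue with
real part zero. -/
def IsPrimitive {S : Type} (L : Matrix S S ℂ →ₗ[ℂ] Matrix S S ℂ) : Prop :=
  Module.finrank ℂ (Module.End.maxGenEigenspace L 0) = 1 ∧
    ∀ μ : ℂ, Module.End.HasEigenvalue L μ → μ.re = 0 → μ = 0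

/-- `ρ` is a state with `L^*(ρ) = 0`, where `L^*` is the dual of `L` for the pairing
`(ρ, A) ↦ Tr (ρ A)`. -/
def IsStationaryState {S : Type} [Fintype S]
    (L : Matrix S S ℂ →ₗ[ℂ] Matrix S S ℂ) (ρ : Matrix S S ℂ) : Prop :=
  IsState ρ ∧ ∀ A, (ρ * L A).trace = 0

end

end QuantumThermal

namespace QuantumThermal

open Matrix
open scoped Kronecker

noncomputable section

/-! The model is a classical Markov chain on a cycle. The system has levels indexed by `Fin n` and
zero Hamiltonian; bath `i` is a two-level system with energies `0` and `J i`, flipped whenever the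
system steps between `i` and `i + 1`. Energy conservation requires `e i - e (i + 1) = J i`, and such
energies exist around the cycle because the `J i` sum to zero.

The interactions have no diagonal blocks in the bath basis, so different baths do not interfere
(`interactionMap_sum_extend`), and each bath contributes jumps with rates given by its Gibbs weights
(`interactionMap_single_add_single`). Thus off-diagonal matrix entries decay and diagonal entries
follow the chain. Irreducibility then gives positivity improvement
(`isPositivityImproving_jumpMap`), while the Dirichlet form at a positive stationary measure gives
primitivity and uniqueness (`isPrimitive_jumpMap`, `IsStationaryState.eq_diagonal`).

A current that is constant along the cycle makes `p` stationary, and a unit current delivers exactly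
`J i` to bath `i` (`cycleRate_stationary`, `cycleModel_flux`). The affinity `∑ β i * J i` is the
only obstruction to a forward current on every edge: if it is positive, `p` can share it evenly
among the edges, and the coupling constants then normalise every current to one
(`exists_unit_current`). -/

/-- The completely positive map `A ↦ ∑ R s t ⟨t|A|t⟩ |s⟩⟨s|` given by classical jumps `s → t`
at rates `R s t`. -/
def jumpMap {S : Type} [Fintype S] [DecidableEq S] (R : Matrix S S ℝ) :
    Matrix S S ℂ →ₗ[ℂ] Matrix S S ℂ where
  toFun A := diagonal fun s => ∑ t, (R s t : ℂ) * A t t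
  map_add' A A' := by
    rw [diagonal_add]
    simp only [Matrix.add_apply, mul_add, Finset.sum_add_distrib]
  map_smul' c A := by
    rw [← diagonal_smul]
    congr 1
    ext s
    simp only [Matrix.smul_apply, smul_eq_mul, RingHom.id_apply, Pi.smul_apply, Finset.mul_sum]
    exact Finset.sum_congr rfl fun t _ => by ring

/-! ### Jump Lindbladians: explicit semigroup and positivity improvement -/

section Jump

variable {S : Type} [Fintype S] [DecidableEq S] {R : Matrix S S ℝ}

theorem jumpMap_apply (A : Matrix S S ℂ) :
    jumpMap R A = diagonal fun s => ∑ t, (R s t : ℂ) * A t t := rfl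

theorem jumpMap_sum {ι : Type} [Fintype ι] (R : ι → Matrix S S ℝ) :
    ∑ i, jumpMap (R i) = jumpMap (∑ i, R i) := by
  ext1 A
  ext s t
  rw [LinearMap.sum_apply, Matrix.sum_apply]
  by_cases h : s = t
  · subst h
    simp only [jumpMap_apply, diagonal_apply_eq, Matrix.sum_apply]
    rw [Finset.sum_comm]
    simp [Finset.sum_mul]
  · simp [jumpMap_apply, h]

theorem jumpMap_one : jumpMap R 1 = diagonal fun s => ((∑ t, R s t : ℝ) : ℂ) := by
  simp [jumpMap_apply]

/-- The image of `jumpMap` is diagonal, so off the diagonal only the anticommutator with the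
diagonal matrix of exit rates survives. -/
theorem dissipator_jumpMap_apply_ne (A : Matrix S S ℂ) {s t : S} (h : s ≠ t) :
    dissipator (jumpMap R) A s t =
      -(((∑ u, R s u + ∑ u, R t u) / 2 : ℝ) : ℂ) * A s t := by
  rw [dissipator, jumpMap_one]
  simp only [LinearMap.sub_apply, LinearMap.smul_apply,
    LinearMap.add_apply, LinearMap.mulLeft_apply, LinearMap.mulRight_apply, Matrix.sub_apply,
    Matrix.smul_apply, Matrix.add_apply, diagonal_mul, mul_diagonal, jumpMap_apply,
    diagonal_apply_ne _ h, smul_eq_mul]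
  push_cast
  ring

theorem dissipator_jumpMap_apply_self (A : Matrix S S ℂ) (s : S) :
    dissipator (jumpMap R) A s s = ∑ t, (R s t : ℂ) * (A t t - A s s) := by
  rw [dissipator, jumpMap_one]
  simp only [LinearMap.sub_apply, LinearMap.smul_apply,
    LinearMap.add_apply, LinearMap.mulLeft_apply, LinearMap.mulRight_apply, Matrix.sub_apply,
    Matrix.smul_apply, Matrix.add_apply, diagonal_mul, mul_diagonal, jumpMap_apply,
    diagonal_apply_eq, smul_eq_mul, mul_sub, Finset.sum_sub_distrib, ← Finset.sum_mul]
  push_cast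
  ring

/-- The generator of the Markov chain with jump rates `R`. -/
def chainGenerator (R : Matrix S S ℝ) : Matrix S S ℝ :=
  R - diagonal fun s => ∑ t, R s t

theorem dissipator_jumpMap_diag (A : Matrix S S ℂ) (s : S) :
    dissipator (jumpMap R) A s s = ∑ t, (chainGenerator R s t : ℂ) * A t t := by
  rw [dissipator_jumpMap_apply_self]
  simp only [chainGenerator, Matrix.sub_apply, Complex.ofReal_sub, sub_mul, mul_sub,
    Finset.sum_sub_distrib, diagonal_apply]
  simp [Finset.sum_mul, apply_ite Complex.ofReal, ite_mul]

theorem pow_dissipator_jumpMap_ne (A : Matrix S S ℂ) {s t : S} (h : s ≠ t) (k : ℕ) :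
    (dissipator (jumpMap R) ^ k) A s t =
      (-(((∑ u, R s u + ∑ u, R t u) / 2 : ℝ) : ℂ)) ^ k * A s t := by
  induction k with
  | zero => simp
  | succ k ih =>
    rw [pow_succ', Module.End.mul_apply, dissipator_jumpMap_apply_ne _ h, ih, pow_succ']
    ring

theorem pow_dissipator_jumpMap_diag (A : Matrix S S ℂ) (k : ℕ) (s : S) :
    (dissipator (jumpMap R) ^ k) A s s = ∑ t, ((chainGenerator R ^ k) s t : ℂ) * A t t := by
  induction k generalizing s with
  | zero => simp [Matrix.one_apply, apply_ite Complex.ofReal, ite_mul]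
  | succ k ih =>
    rw [pow_succ', Module.End.mul_apply, dissipator_jumpMap_diag, pow_succ']
    simp only [ih, Matrix.mul_apply, Complex.ofReal_sum, Complex.ofReal_mul, Finset.sum_mul,
      Finset.mul_sum]
    rw [Finset.sum_comm]
    simp only [mul_assoc]

theorem hasSum_exp_apply (Q : Matrix S S ℝ) (t : ℝ) (s u : S) :
    HasSum (fun k : ℕ => t ^ k / (k.factorial : ℝ) * (Q ^ k) s u)
      (NormedSpace.exp (t • Q) s u) := by
  open scoped Matrix.Norms.Operator in
  have h := NormedSpace.exp_series_hasSum_exp' (𝕂 := ℝ) (t • Q)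
  have h2 := (Pi.hasSum.1 ((Pi.hasSum.1 h) s)) u
  have h3 : (fun k : ℕ => t ^ k / (k.factorial : ℝ) * (Q ^ k) s u) =
      fun k : ℕ => ((k.factorial : ℝ)⁻¹ • (t • Q) ^ k) s u := by
    ext k
    simp only [smul_pow, Matrix.smul_apply, smul_eq_mul]
    ring
  rw [h3]
  exact h2

theorem semigroup_apply_hasSum {S : Type} [Fintype S] (L : Matrix S S ℂ →ₗ[ℂ] Matrix S S ℂ) (t : ℝ)
    (A : Matrix S S ℂ) (s u : S) :
    HasSum (fun k : ℕ => (t : ℂ) ^ k / (k.factorial : ℂ) * (L ^ k) A s u)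
      (semigroup L t A s u) :=
  (Pi.hasSum.1 ((Pi.hasSum.1 (hasSum_semigroup L t A)) s)) u

/-- The decay factor splits into one factor per index, which exhibits these entries as those of a
conjugation `G * A * Gᴴ` with `G` diagonal. -/
theorem semigroup_jumpMap_ne (A : Matrix S S ℂ) (t : ℝ) {s u : S} (h : s ≠ u) :
    semigroup (dissipator (jumpMap R)) t A s u =
      (Real.exp (-t * (∑ v, R s v) / 2) : ℂ) * A s u * (Real.exp (-t * (∑ v, R u v) / 2) : ℂ) := by
  refine (semigroup_apply_hasSum _ t A s u).unique ?_
  have h1 := (NormedSpace.exp_series_hasSum_exp' (𝕂 := ℂ)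
    ((t : ℂ) * -(((∑ v, R s v + ∑ v, R u v) / 2 : ℝ) : ℂ))).mul_right (A s u)
  have h2 : NormedSpace.exp ((t : ℂ) * -(((∑ v, R s v + ∑ v, R u v) / 2 : ℝ) : ℂ)) * A s u =
      (Real.exp (-t * (∑ v, R s v) / 2) : ℂ) * A s u *
        (Real.exp (-t * (∑ v, R u v) / 2) : ℂ) := by
    rw [← Complex.exp_eq_exp_ℂ, mul_right_comm, ← Complex.ofReal_mul, ← Real.exp_add,
      Complex.ofReal_exp]
    congr 2
    push_cast
    ring
  rw [← h2]
  refine (congrArg (fun f => HasSum f _) (funext fun k => ?_)).mpr h1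
  rw [pow_dissipator_jumpMap_ne A h, smul_eq_mul, mul_pow]
  ring

theorem semigroup_jumpMap_diag (A : Matrix S S ℂ) (t : ℝ) (s : S) :
    semigroup (dissipator (jumpMap R)) t A s s =
      ∑ u, (NormedSpace.exp (t • chainGenerator R) s u : ℂ) * A u u := by
  refine (semigroup_apply_hasSum _ t A s s).unique ?_
  have h : ∀ u, HasSum (fun k : ℕ => ((t ^ k / (k.factorial : ℝ) *
      (chainGenerator R ^ k) s u : ℝ) : ℂ) * A u u)
      ((NormedSpace.exp (t • chainGenerator R) s u : ℂ) * A u u) := fun u =>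
    (Complex.hasSum_ofReal.2 (hasSum_exp_apply (chainGenerator R) t s u)).mul_right _
  convert hasSum_sum fun u (_ : u ∈ Finset.univ) => h u using 2 with k
  rw [pow_dissipator_jumpMap_diag, Finset.mul_sum]
  refine Finset.sum_congr rfl fun u _ => ?_
  push_cast
  ring

theorem pow_apply_nonneg {P : Matrix S S ℝ} (hP : ∀ s t, 0 ≤ P s t) (k : ℕ) (s t : S) :
    0 ≤ (P ^ k) s t := by
  induction k generalizing s with
  | zero => rw [pow_zero, Matrix.one_apply]; split_ifs <;> norm_num
  | succ k ih =>
    rw [pow_succ', Matrix.mul_apply]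
    exact Finset.sum_nonneg fun u _ => mul_nonneg (hP s u) (ih u)

theorem pow_apply_mono {P P' : Matrix S S ℝ} (hP : ∀ s t, 0 ≤ P s t)
    (hPP' : ∀ s t, P s t ≤ P' s t) (k : ℕ) (s t : S) : (P ^ k) s t ≤ (P' ^ k) s t := by
  induction k generalizing s with
  | zero => simp
  | succ k ih =>
    rw [pow_succ', pow_succ', Matrix.mul_apply, Matrix.mul_apply]
    exact Finset.sum_le_sum fun u _ => mul_le_mul (hPP' s u) (ih u)
      (pow_apply_nonneg hP k u t) ((hP s u).trans (hPP' s u))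

/-- Expanding the power, the mixed words in `P` and `D` are nonnegative. For `k = 0` the identity
would be counted twice on the left. -/
theorem pow_add_pow_le_add_pow {P D : Matrix S S ℝ} (hP : ∀ s t, 0 ≤ P s t)
    (hD : ∀ s t, 0 ≤ D s t) {k : ℕ} (hk : 0 < k) (s t : S) :
    (P ^ k) s t + (D ^ k) s t ≤ ((P + D) ^ k) s t := by
  obtain ⟨k, rfl⟩ := Nat.exists_eq_add_one.2 hk
  rw [pow_succ', pow_succ', pow_succ', Matrix.add_mul, Matrix.add_apply]
  refine add_le_add ?_ ?_ <;> rw [Matrix.mul_apply, Matrix.mul_apply]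
  · exact Finset.sum_le_sum fun u _ => mul_le_mul_of_nonneg_left
      (pow_apply_mono hP (fun a b => le_add_of_nonneg_right (hD a b)) k u t) (hP s u)
  · exact Finset.sum_le_sum fun u _ => mul_le_mul_of_nonneg_left
      (pow_apply_mono hD (fun a b => le_add_of_nonneg_left (hP a b)) k u t) (hD s u)

theorem exp_apply_lt_exp_add_apply {P D : Matrix S S ℝ} (hP : ∀ s t, 0 ≤ P s t)
    (hD : ∀ s t, 0 ≤ D s t) {t : ℝ} (ht : 0 < t) {s u : S}
    (h : ∃ k, 0 < k ∧ 0 < (P ^ k) s u) :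
    NormedSpace.exp (t • D) s u < NormedSpace.exp (t • (P + D)) s u := by
  obtain ⟨k, hk, hpos⟩ := h
  refine hasSum_lt (i := k) (fun j => ?_) ?_ (hasSum_exp_apply D t s u)
    (hasSum_exp_apply (P + D) t s u)
  · exact mul_le_mul_of_nonneg_left
      (pow_apply_mono hD (fun a b => le_add_of_nonneg_left (hP a b)) j s u) (by positivity)
  · refine mul_lt_mul_of_pos_left ?_ (by positivity)
    linarith [pow_add_pow_le_add_pow hP hD hk s u]

theorem exp_smul_sub_scalar (P : Matrix S S ℝ) (t l : ℝ) :
    NormedSpace.exp (t • (P - diagonal fun _ => l)) =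
      Real.exp (-(t * l)) • NormedSpace.exp (t • P) := by
  have h : t • (P - diagonal fun _ => l) = (diagonal fun _ => -(t * l)) + t • P := by
    rw [smul_sub, ← diagonal_smul, sub_eq_neg_add, diagonal_neg]
    rfl
  have hc : Commute (diagonal fun _ : S => -(t * l)) (t • P) :=
    Matrix.scalar_commute _ (fun _ => Commute.all _ _) _
  rw [h, Matrix.exp_add_of_commute _ _ hc, Matrix.exp_diagonal]
  ext a b
  rw [diagonal_mul, Matrix.smul_apply, smul_eq_mul, Pi.coe_exp, Real.exp_eq_exp_ℝ]

/-- If jumps lead from `s` to `u`, the transition probability of the chain is strictly larger than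
the probability of not jumping at all. -/
theorem exp_neg_rate_lt_exp_chainGenerator (hR : ∀ s t, 0 ≤ R s t) {t : ℝ} (ht : 0 < t) {s u : S}
    (h : ∃ k, 0 < k ∧ 0 < (R ^ k) s u) :
    (diagonal fun s => Real.exp (-t * ∑ v, R s v) : Matrix S S ℝ) s u <
      NormedSpace.exp (t • chainGenerator R) s u := by
  -- Uniformisation: the sum of all rates dominates every exit rate, so after a shift by `l` both
  -- the generator and its no-jump part become nonnegative and their exponential series compare
  -- termwise.
  set l : ℝ := ∑ a, ∑ b, R a b with hl
  set D : Matrix S S ℝ := diagonal fun s => l - ∑ v, R s v with hDdef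
  have hD : ∀ a b, 0 ≤ D a b := by
    intro a b
    rw [hDdef, diagonal_apply]
    split_ifs
    · exact sub_nonneg.2 (Finset.single_le_sum (f := fun a => ∑ b, R a b)
        (fun c _ => Finset.sum_nonneg fun d _ => hR c d) (Finset.mem_univ a))
    · exact le_rfl
  have h1 : chainGenerator R = (R + D) - diagonal fun _ => l := by
    rw [add_sub_assoc, hDdef, diagonal_sub, chainGenerator, sub_eq_add_neg, diagonal_neg]
    congr 2
    ext a
    simp
  have h2 : (diagonal fun s => Real.exp (-t * ∑ v, R s v) : Matrix S S ℝ) =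
      Real.exp (-(t * l)) • NormedSpace.exp (t • D) := by
    rw [← exp_smul_sub_scalar, hDdef, diagonal_sub, ← diagonal_smul, Matrix.exp_diagonal]
    congr 1
    ext a
    rw [Pi.coe_exp, Real.exp_eq_exp_ℝ]
    simp
  rw [h1, h2, exp_smul_sub_scalar, Matrix.smul_apply, Matrix.smul_apply]
  exact mul_lt_mul_of_pos_left (exp_apply_lt_exp_add_apply hR hD ht h) (Real.exp_pos _)

/-- The no-jump evolution `A ↦ G * A * Gᴴ` preserves positivity. What remains is diagonal, and its
entries `w s` are strictly positive because every transition probability exceeds its no-jump part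
and `A` has a positive diagonal entry. -/
theorem isPositivityImproving_jumpMap (hR : ∀ s t, 0 ≤ R s t)
    (hirr : ∀ s t, ∃ k, 0 < k ∧ 0 < (R ^ k) s t) :
    IsPositivityImproving (dissipator (jumpMap R)) := by
  intro t ht A hA hA0
  set G : Matrix S S ℂ := diagonal fun s => (Real.exp (-t * (∑ v, R s v) / 2) : ℂ) with hG
  set w : S → ℝ := fun s => ∑ u, (NormedSpace.exp (t • chainGenerator R) s u -
    (diagonal fun s => Real.exp (-t * ∑ v, R s v) : Matrix S S ℝ) s u) * (A u u).re with hw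
  have hdiag : ∀ u, ((A u u).re : ℂ) = A u u := fun u => by
    have := hA.diag_nonneg (i := u)
    rw [Complex.nonneg_iff] at this
    exact Complex.ext rfl this.2
  have hre : ∀ u, 0 ≤ (A u u).re := fun u => (Complex.nonneg_iff.1 (hA.diag_nonneg (i := u))).1
  have hdec : semigroup (dissipator (jumpMap R)) t A =
      G * A * Gᴴ + diagonal fun s => (w s : ℂ) := by
    ext s u
    by_cases h : s = u
    · subst h
      rw [semigroup_jumpMap_diag, Matrix.add_apply, hG, diagonal_conjTranspose, mul_diagonal,
        diagonal_mul, diagonal_apply_eq]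
      have he : ((Real.exp (-t * (∑ v, R s v) / 2) : ℝ) : ℂ) * A s s *
          star (fun s => ((Real.exp (-t * (∑ v, R s v) / 2) : ℝ) : ℂ)) s =
          ∑ u, ((diagonal fun s => Real.exp (-t * ∑ v, R s v) : Matrix S S ℝ) s u : ℂ) * A u u := by
        simp only [diagonal_apply, Pi.star_apply, apply_ite Complex.ofReal, ite_mul,
          Complex.ofReal_zero, zero_mul, Finset.sum_ite_eq, Finset.mem_univ, if_true,
          RCLike.star_def, Complex.conj_ofReal]
        rw [mul_right_comm, ← Complex.ofReal_mul, ← Real.exp_add]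
        congr 3
        ring
      rw [he, hw]
      push_cast
      rw [← Finset.sum_add_distrib]
      refine Finset.sum_congr rfl fun u _ => ?_
      rw [hdiag]
      ring
    · rw [semigroup_jumpMap_ne A t h, Matrix.add_apply, hG, diagonal_conjTranspose, mul_diagonal,
        diagonal_mul, diagonal_apply_ne _ h, add_zero]
      simp only [Pi.star_apply, RCLike.star_def, Complex.conj_ofReal]
  have hex : ∃ u, 0 < (A u u).re := by
    by_contra! hcon
    refine hA0 (hA.trace_eq_zero_iff.1 ?_)
    refine Finset.sum_eq_zero fun u _ => ?_
    rw [diag_apply, ← hdiag u, le_antisymm (hcon u) (hre u), Complex.ofReal_zero]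
  have hwpos : ∀ s, 0 < w s := by
    intro s
    obtain ⟨u, hu⟩ := hex
    refine Finset.sum_pos' (fun v _ => mul_nonneg ?_ (hre v)) ⟨u, Finset.mem_univ u, mul_pos ?_ hu⟩
    · exact (sub_pos.2 (exp_neg_rate_lt_exp_chainGenerator hR ht (hirr s v))).le
    · exact sub_pos.2 (exp_neg_rate_lt_exp_chainGenerator hR ht (hirr s u))
  rw [hdec]
  refine Matrix.PosDef.posSemidef_add (hA.mul_mul_conjTranspose_same G) ?_
  exact Matrix.PosDef.diagonal fun s => by exact_mod_cast hwpos s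

end Jump

/-! ### Primitivity and uniqueness of the stationary state -/

section Primitive

variable {S : Type} [Fintype S] [DecidableEq S] {R : Matrix S S ℝ} {p : S → ℝ}

theorem sum_rate_pos (hR : ∀ s t, 0 ≤ R s t) (hirr : ∀ s t, ∃ k, 0 < k ∧ 0 < (R ^ k) s t)
    (s : S) : 0 < ∑ t, R s t := by
  obtain ⟨k, hk, hpos⟩ := hirr s s
  obtain ⟨k, rfl⟩ := Nat.exists_eq_add_one.2 hk
  rw [pow_succ', Matrix.mul_apply] at hpos
  obtain ⟨u, -, hu⟩ := Finset.exists_lt_of_sum_lt (f := fun _ => (0 : ℝ)) (by simpa using hpos)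
  refine Finset.sum_pos' (fun t _ => hR s t) ⟨u, Finset.mem_univ u, (hR s u).lt_of_ne fun h => ?_⟩
  simp [← h] at hu

theorem eq_of_pow_apply_pos (hR : ∀ s t, 0 ≤ R s t) {g : S → ℂ}
    (hg : ∀ s t, 0 < R s t → g s = g t) (k : ℕ) {s t : S} (h : 0 < (R ^ k) s t) : g s = g t := by
  induction k generalizing s with
  | zero =>
    rw [pow_zero, Matrix.one_apply] at h
    split_ifs at h with hst
    · rw [hst]
    · exact absurd h (lt_irrefl _)
  | succ k ih =>
    rw [pow_succ', Matrix.mul_apply] at h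
    obtain ⟨u, -, hu⟩ := Finset.exists_lt_of_sum_lt (f := fun _ => (0 : ℝ)) (by simpa using h)
    have h1 : 0 < R s u := (hR s u).lt_of_ne fun h0 => by simp [← h0] at hu
    exact (hg s u h1).trans (ih (pos_of_mul_pos_right hu (hR s u)))

/-- The Dirichlet form of a Markov chain with stationary measure `p`. -/
theorem re_sum_conj_mul_generator {S : Type} [Fintype S] {R : Matrix S S ℝ} {p : S → ℝ}
    (hp : ∀ t, ∑ s, p s * R s t = p t * ∑ s, R t s) (g : S → ℂ) :
    (∑ s, (p s : ℂ) * (starRingEnd ℂ (g s) * ∑ t, (R s t : ℂ) * (g t - g s))).re =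
      -(∑ s, ∑ t, p s * R s t * Complex.normSq (g t - g s)) / 2 := by
  -- Polarisation: `2 Re (conj a * (b - a)) = |b|² - |a|² - |b - a|²`. Stationarity cancels the
  -- first two terms after summation.
  have hpt : ∀ s t, ((p s : ℂ) * (starRingEnd ℂ (g s) * ((R s t : ℂ) * (g t - g s)))).re =
      p s * R s t * (Complex.normSq (g t)) / 2 - p s * R s t * Complex.normSq (g s) / 2 -
        p s * R s t * Complex.normSq (g t - g s) / 2 := by
    intro s t
    simp only [Complex.mul_re, Complex.mul_im, Complex.ofReal_re, Complex.ofReal_im,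
      Complex.conj_re, Complex.conj_im, Complex.sub_re, Complex.sub_im, Complex.normSq_apply]
    ring
  have hstat : ∑ s, ∑ t, p s * R s t * Complex.normSq (g t) / 2 =
      ∑ s, ∑ t, p s * R s t * Complex.normSq (g s) / 2 := by
    rw [Finset.sum_comm]
    refine Finset.sum_congr rfl fun t _ => ?_
    rw [← Finset.sum_div, ← Finset.sum_mul, hp, ← Finset.sum_div, ← Finset.sum_mul,
      Finset.mul_sum]
  simp only [Finset.mul_sum, Complex.re_sum, hpt, Finset.sum_sub_distrib, hstat]
  simp only [← Finset.sum_div]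
  ring

/-- A vanishing sum of nonnegative terms makes `g` equal across every edge of positive rate, and
irreducibility connects all states. -/
theorem eq_of_re_dirichlet_eq_zero (hR : ∀ s t, 0 ≤ R s t)
    (hirr : ∀ s t, ∃ k, 0 < k ∧ 0 < (R ^ k) s t) (hp0 : ∀ s, 0 < p s)
    (hp : ∀ t, ∑ s, p s * R s t = p t * ∑ s, R t s) {g : S → ℂ}
    (h : (∑ s, (p s : ℂ) * (starRingEnd ℂ (g s) * ∑ t, (R s t : ℂ) * (g t - g s))).re = 0)
    (s t : S) : g s = g t := by
  rw [re_sum_conj_mul_generator hp, neg_div, neg_eq_zero, div_eq_zero_iff,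
    or_iff_left two_ne_zero] at h
  have hnn : ∀ s t, 0 ≤ p s * R s t * Complex.normSq (g t - g s) := fun s t =>
    mul_nonneg (mul_nonneg (hp0 s).le (hR s t)) (Complex.normSq_nonneg _)
  rw [Finset.sum_eq_zero_iff_of_nonneg fun s _ => Finset.sum_nonneg fun t _ => hnn s t] at h
  obtain ⟨k, -, hk⟩ := hirr s t
  refine eq_of_pow_apply_pos hR (fun a b hab => ?_) k hk
  have h1 := (Finset.sum_eq_zero_iff_of_nonneg fun t _ => hnn a t).1 (h a (Finset.mem_univ a)) b
    (Finset.mem_univ b)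
  have h2 := (mul_eq_zero.1 h1).resolve_left (mul_pos (hp0 a) hab).ne'
  exact (sub_eq_zero.1 (Complex.normSq_eq_zero.1 h2)).symm

theorem dissipator_jumpMap_one : dissipator (jumpMap R) 1 = 0 := by
  ext s t
  by_cases h : s = t
  · subst h
    simp [dissipator_jumpMap_apply_self]
  · simp [dissipator_jumpMap_apply_ne _ h, h]

theorem trace_diagonal_mul_dissipator_jumpMap (A : Matrix S S ℂ) :
    ((diagonal fun s => (p s : ℂ)) * dissipator (jumpMap R) A).trace =
      ∑ s, (p s : ℂ) * ∑ t, (R s t : ℂ) * (A t t - A s s) := by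
  simp [Matrix.trace, diagonal_mul, dissipator_jumpMap_apply_self]

theorem trace_diagonal_mul_dissipator_jumpMap_eq_zero
    (hp : ∀ t, ∑ s, p s * R s t = p t * ∑ s, R t s) (A : Matrix S S ℂ) :
    ((diagonal fun s => (p s : ℂ)) * dissipator (jumpMap R) A).trace = 0 := by
  rw [trace_diagonal_mul_dissipator_jumpMap]
  simp only [mul_sub, Finset.mul_sum, Finset.sum_sub_distrib]
  rw [Finset.sum_comm, sub_eq_zero]
  refine Finset.sum_congr rfl fun t _ => ?_
  have h : (∑ s, (p s : ℂ) * R s t) = p t * ∑ s, (R t s : ℂ) := by exact_mod_cast hp t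
  simp only [← mul_assoc, ← Finset.sum_mul, ← Finset.mul_sum, h]

/-- An eigenvector of the jump Lindbladian to a purely imaginary eigenvalue is a multiple of the
identity. -/
theorem exists_eq_smul_one_of_dissipator_jumpMap_eq_smul [Nonempty S] (hR : ∀ s t, 0 ≤ R s t)
    (hirr : ∀ s t, ∃ k, 0 < k ∧ 0 < (R ^ k) s t) (hp0 : ∀ s, 0 < p s)
    (hp : ∀ t, ∑ s, p s * R s t = p t * ∑ s, R t s) {μ : ℂ} (hμ : μ.re = 0)
    {A : Matrix S S ℂ} (hA : dissipator (jumpMap R) A = μ • A) : ∃ c : ℂ, A = c • 1 := by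
  have hoff : ∀ s t, s ≠ t → A s t = 0 := by
    intro s t hst
    have h1 := congrFun (congrFun hA s) t
    rw [dissipator_jumpMap_apply_ne _ hst, Matrix.smul_apply, smul_eq_mul, ← sub_eq_zero,
      ← sub_mul] at h1
    refine (mul_eq_zero.1 h1).resolve_left fun h2 => ?_
    have h3 := congrArg Complex.re h2
    rw [Complex.sub_re, Complex.neg_re, Complex.ofReal_re, hμ, Complex.zero_re] at h3
    linarith [sum_rate_pos hR hirr s, sum_rate_pos hR hirr t]
  -- Pairing the eigenvalue equation with the diagonal of `A` itself gives `μ` times a real number,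
  -- whose real part is zero.
  have hdiag : ∀ s t, A s s = A t t := by
    refine eq_of_re_dirichlet_eq_zero (g := fun s => A s s) hR hirr hp0 hp ?_
    simp only [← dissipator_jumpMap_apply_self, hA, Matrix.smul_apply, smul_eq_mul]
    rw [Complex.re_sum]
    refine Finset.sum_eq_zero fun s _ => ?_
    rw [mul_left_comm _ μ, ← Complex.normSq_eq_conj_mul_self, mul_left_comm, ← Complex.ofReal_mul,
      Complex.re_mul_ofReal, hμ, zero_mul]
  obtain ⟨s0⟩ := ‹Nonempty S›
  refine ⟨A s0 s0, ?_⟩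
  ext s t
  by_cases h : s = t
  · subst h
    simp [hdiag s s0]
  · simp [hoff s t h, h]

theorem isPrimitive_jumpMap [Nonempty S] (hR : ∀ s t, 0 ≤ R s t)
    (hirr : ∀ s t, ∃ k, 0 < k ∧ 0 < (R ^ k) s t) (hp0 : ∀ s, 0 < p s)
    (hp : ∀ t, ∑ s, p s * R s t = p t * ∑ s, R t s) :
    IsPrimitive (dissipator (jumpMap R)) := by
  have hker : ∀ A, dissipator (jumpMap R) A = 0 → ∃ c : ℂ, A = c • 1 := fun A hA =>
    exists_eq_smul_one_of_dissipator_jumpMap_eq_smul hR hirr hp0 hp (μ := 0) rfl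
      (by rw [hA, zero_smul])
  -- There is no Jordan chain above the identity: the trace against `p` vanishes on the range of the
  -- generator but not on the identity.
  have hgen : ∀ (k : ℕ) (A), (dissipator (jumpMap R) ^ k) A = 0 → ∃ c : ℂ, A = c • 1 := by
    intro k
    induction k with
    | zero => exact fun A hA => ⟨0, by simpa using hA⟩
    | succ k ih =>
      intro A hA
      rw [pow_succ, Module.End.mul_apply] at hA
      obtain ⟨c, hc⟩ := ih _ hA
      have htr := trace_diagonal_mul_dissipator_jumpMap_eq_zero hp A
      rw [hc, Matrix.mul_smul, Matrix.mul_one, Matrix.trace_smul, trace_diagonal, smul_eq_mul,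
        ← Complex.ofReal_sum, mul_eq_zero, Complex.ofReal_eq_zero] at htr
      have hpos : 0 < ∑ s, p s := Finset.sum_pos (fun s _ => hp0 s) Finset.univ_nonempty
      rw [htr.resolve_right hpos.ne', zero_smul] at hc
      exact hker A hc
  refine ⟨?_, fun μ hμ hre => ?_⟩
  · have hspan : Module.End.maxGenEigenspace (dissipator (jumpMap R)) 0 =
        Submodule.span ℂ {(1 : Matrix S S ℂ)} := by
      ext A
      rw [Module.End.mem_maxGenEigenspace, Submodule.mem_span_singleton, zero_smul, sub_zero]
      constructor
      · rintro ⟨k, hk⟩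
        obtain ⟨c, hc⟩ := hgen k A hk
        exact ⟨c, hc.symm⟩
      · rintro ⟨c, rfl⟩
        exact ⟨1, by rw [pow_one, map_smul, dissipator_jumpMap_one, smul_zero]⟩
    rw [hspan]
    exact finrank_span_singleton one_ne_zero
  · obtain ⟨A, hA⟩ := hμ.exists_hasEigenvector
    obtain ⟨c, hc⟩ := exists_eq_smul_one_of_dissipator_jumpMap_eq_smul hR hirr hp0 hp hre
      hA.apply_eq_smul
    have h1 := hA.apply_eq_smul
    rw [hc, map_smul, dissipator_jumpMap_one, smul_zero, ← hc] at h1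
    exact (smul_eq_zero.1 h1.symm).resolve_right hA.2

theorem isStationaryState_diagonal (hp0 : ∀ s, 0 < p s) (hp1 : ∑ s, p s = 1)
    (hp : ∀ t, ∑ s, p s * R s t = p t * ∑ s, R t s) :
    IsStationaryState (dissipator (jumpMap R)) (diagonal fun s => (p s : ℂ)) := by
  refine ⟨⟨?_, ?_⟩, trace_diagonal_mul_dissipator_jumpMap_eq_zero hp⟩
  · exact PosSemidef.diagonal fun s => Complex.zero_le_real.2 (hp0 s).le
  · rw [trace_diagonal]
    exact_mod_cast hp1

/-- Off-diagonal matrix units are eigenvectors with nonzero eigenvalue, so testing against them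
kills the off-diagonal of `ρ`. The density `g` of the diagonal with respect to `p` is constant by
the Dirichlet form, and the trace fixes the constant. -/
theorem IsStationaryState.eq_diagonal [Nonempty S] (hR : ∀ s t, 0 ≤ R s t)
    (hirr : ∀ s t, ∃ k, 0 < k ∧ 0 < (R ^ k) s t) (hp0 : ∀ s, 0 < p s) (hp1 : ∑ s, p s = 1)
    (hp : ∀ t, ∑ s, p s * R s t = p t * ∑ s, R t s) {ρ : Matrix S S ℂ}
    (hρ : IsStationaryState (dissipator (jumpMap R)) ρ) : ρ = diagonal fun s => (p s : ℂ) := by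
  obtain ⟨⟨-, htr⟩, hst⟩ := hρ
  have hoff : ∀ s t, s ≠ t → ρ s t = 0 := by
    intro s t hst'
    have hL : dissipator (jumpMap R) (single t s 1) =
        -(((∑ u, R t u + ∑ u, R s u) / 2 : ℝ) : ℂ) • single t s 1 := by
      ext a b
      by_cases hab : a = b
      · subst hab
        have h0 : ∀ c, (single t s (1 : ℂ)) c c = 0 := fun c =>
          single_apply_of_ne _ _ _ _ _ fun h => hst' (h.2.trans h.1.symm)
        simp [dissipator_jumpMap_apply_self, h0]
      · rw [dissipator_jumpMap_apply_ne _ hab, Matrix.smul_apply, smul_eq_mul]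
        by_cases h : t = a ∧ s = b
        · rw [h.1, h.2]
        · rw [single_apply_of_ne _ _ _ _ _ h, mul_zero, mul_zero]
    have h1 := hst (single t s 1)
    rw [hL, Matrix.mul_smul, Matrix.trace_smul, Matrix.trace_mul_single, smul_eq_mul,
      mul_eq_zero] at h1
    have h2 : (-(((∑ u, R t u + ∑ u, R s u) / 2 : ℝ) : ℂ)) ≠ 0 := by
      rw [neg_ne_zero, Complex.ofReal_ne_zero]
      linarith [sum_rate_pos hR hirr s, sum_rate_pos hR hirr t]
    simpa using h1.resolve_left h2
  set g : S → ℂ := fun s => ρ s s / p s with hg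
  have hp0' : ∀ s, (p s : ℂ) ≠ 0 := fun s => Complex.ofReal_ne_zero.2 (hp0 s).ne'
  have hconst : ∀ s t, g s = g t := by
    refine eq_of_re_dirichlet_eq_zero hR hirr hp0 hp ?_
    -- The test observable is the conjugate of the density, so that stationarity becomes, after
    -- conjugation, the Dirichlet form of `g`.
    have h1 := hst (diagonal fun s => starRingEnd ℂ (g s))
    have h2 : ∑ s, ρ s s * ∑ t, (R s t : ℂ) * (starRingEnd ℂ (g t) - starRingEnd ℂ (g s)) = 0 := by
      rw [← h1, Matrix.trace]
      refine Finset.sum_congr rfl fun s _ => ?_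
      rw [diag_apply, Matrix.mul_apply, Finset.sum_eq_single_of_mem (f := fun t => ρ s t * _) s
        (Finset.mem_univ s) fun t _ hts => by rw [hoff s t hts.symm, zero_mul],
        dissipator_jumpMap_apply_self]
      simp
    have h3 := congrArg (fun z => (starRingEnd ℂ z).re) h2
    simp only [map_sum, map_mul, map_sub, Complex.conj_conj, Complex.conj_ofReal, map_zero,
      Complex.zero_re] at h3
    rw [← h3]
    congr 1
    refine Finset.sum_congr rfl fun s _ => ?_
    rw [← mul_assoc, hg]
    congr 1
    rw [map_div₀, Complex.conj_ofReal, mul_div_cancel₀ _ (hp0' s)]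
  obtain ⟨s0⟩ := ‹Nonempty S›
  have hval : ∀ s, ρ s s = g s0 * p s := fun s => by
    rw [hconst s0 s, hg, div_mul_cancel₀ _ (hp0' s)]
  have hone : g s0 = 1 := by
    rw [Matrix.trace] at htr
    simp only [diag_apply, hval, ← Finset.mul_sum, ← Complex.ofReal_sum, hp1] at htr
    simpa using htr
  ext s t
  by_cases h : s = t
  · subst h
    rw [hval, hone, one_mul, diagonal_apply_eq]
  · rw [hoff s t h, diagonal_apply_ne _ h]

end Primitive

/-! ### Reduction of bath interactions to jump maps -/

section Bath

theorem interactionMap_diagonal_apply {S : Type} [Fintype S] [DecidableEq S]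
    {B : Type} [Fintype B] [DecidableEq B]
    (H : Matrix (S × B) (S × B) ℂ) (w : B → ℂ) (A : Matrix S S ℂ) (s s' : S) :
    interactionMap H (diagonal w) A s s' =
      ∑ b, w b * (H * (A ⊗ₖ (1 : Matrix B B ℂ)) * H) (s, b) (s', b) := by
  change ∑ b, (H * (A ⊗ₖ (1 : Matrix B B ℂ)) * H *
    ((1 : Matrix S S ℂ) ⊗ₖ diagonal w)) (s, b) (s', b) = _
  refine Finset.sum_congr rfl fun b _ => ?_
  rw [← diagonal_one (n := S), diagonal_kronecker_diagonal, mul_diagonal, one_mul, mul_comm]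

theorem mul_kronecker_one_mul_apply {S : Type} [Fintype S] {B : Type} [Fintype B] [DecidableEq B]
    (H H' : Matrix (S × B) (S × B) ℂ) (A : Matrix S S ℂ) (x y : S × B) :
    (H * (A ⊗ₖ (1 : Matrix B B ℂ)) * H') x y =
      ∑ c, ∑ u, ∑ v, H x (u, c) * A u v * H' (v, c) y := by
  simp only [Matrix.mul_apply, Fintype.sum_prod_type, kroneckerMap_apply, Matrix.one_apply,
    mul_ite, mul_one, mul_zero, Finset.sum_mul]
  rw [Finset.sum_comm]
  refine Finset.sum_congr rfl fun c _ => ?_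
  rw [Finset.sum_comm]
  refine Finset.sum_congr rfl fun u _ => Finset.sum_congr rfl fun v _ => ?_
  simp [ite_mul]

theorem tensorProd_diagonal {ι : Type} [Fintype ι] [DecidableEq ι] {B : ι → Type}
    [∀ i, DecidableEq (B i)] (w : ∀ i, B i → ℂ) :
    tensorProd (fun i => diagonal (w i)) = diagonal fun x : ∀ i, B i => ∏ i, w i (x i) := by
  ext x y
  by_cases h : x = y
  · subst h
    simp [tensorProd]
  · obtain ⟨i, hi⟩ := Function.ne_iff.1 h
    rw [diagonal_apply_ne _ h]
    exact Finset.prod_eq_zero (Finset.mem_univ i) (diagonal_apply_ne _ hi)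

/-- Fubini for a product measure: the normalised factors other than `i` integrate to one. -/
theorem sum_prod_mul_eq {ι : Type} [Fintype ι] [DecidableEq ι] {B : ι → Type}
    [∀ i, Fintype (B i)] (w : ∀ i, B i → ℂ) (hw : ∀ i, ∑ b, w i b = 1) (i : ι) (G : B i → ℂ) :
    ∑ x : ∀ i, B i, (∏ j, w j (x j)) * G (x i) = ∑ b, w i b * G b := by
  have h := Fintype.prod_sum (fun j => Function.update w i (fun b => w i b * G b) j)
  rw [← Finset.mul_prod_erase _ _ (Finset.mem_univ i)] at h
  rw [Finset.prod_eq_one (s := Finset.univ.erase i), mul_one, Function.update_self] at h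
  · rw [h]
    refine Finset.sum_congr rfl fun x _ => ?_
    rw [← Finset.mul_prod_erase _ _ (Finset.mem_univ i),
      ← Finset.mul_prod_erase (a := i) _ _ (Finset.mem_univ i), Function.update_self,
      mul_right_comm]
    congr 1
    refine Finset.prod_congr rfl fun j hj => ?_
    rw [Function.update_of_ne (Finset.ne_of_mem_erase hj)]
  · intro j hj
    rw [Function.update_of_ne (Finset.ne_of_mem_erase hj), hw]

variable {S ι : Type} {B : ι → Type}

theorem extend_apply_self {i : ι} (H : Matrix (S × B i) (S × B i) ℂ) (s s' : S) (x : ∀ i, B i) :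
    extend i H (s, x) (s', x) = H (s, x i) (s', x i) := by
  simp [extend]

theorem extend_apply_update [DecidableEq ι] {i : ι} (H : Matrix (S × B i) (S × B i) ℂ)
    (s s' : S) (x : ∀ i, B i) (b : B i) :
    extend i H (s, x) (s', Function.update x i b) = H (s, x i) (s', b) := by
  simp +contextual [extend]

theorem extend_update_apply [DecidableEq ι] {i : ι} (H : Matrix (S × B i) (S × B i) ℂ)
    (s s' : S) (x : ∀ i, B i) (b : B i) :
    extend i H (s, Function.update x i b) (s', x) = H (s, b) (s', x i) := by
  simp +contextual [extend]

theorem extend_apply_eq_zero [DecidableEq ι] {i : ι} (H : Matrix (S × B i) (S × B i) ℂ) (s s' : S)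
    {x y : ∀ i, B i} (h : ∀ b, y ≠ Function.update x i b) : extend i H (s, x) (s', y) = 0 := by
  rw [extend, of_apply, if_neg]
  intro hxy
  refine h (y i) (funext fun j => ?_)
  by_cases hj : j = i
  · subst hj
    simp
  · rw [Function.update_of_ne hj]
    exact (hxy j hj).symm

/-- The first factor changes at most coordinate `i` of `x`, and the second must undo the change. If
`j ≠ i` it cannot, so coordinate `i` stays fixed and the first factor is a vanishing diagonal block.
-/
theorem extend_mul_extend_apply [Fintype ι] [DecidableEq ι] [∀ i, Fintype (B i)] {i j : ι}
    (H : ∀ i, Matrix (S × B i) (S × B i) ℂ)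
    (hH : ∀ i s s' b, H i (s, b) (s', b) = 0) (s s' u v : S) (x : ∀ i, B i) :
    ∑ y, extend i (H i) (s, x) (u, y) * extend j (H j) (v, y) (s', x) =
      if i = j then ∑ b, H i (s, x i) (u, b) * H i (v, b) (s', x i) else 0 := by
  classical
  split_ifs with hij
  · subst hij
    have hinj : Function.Injective (Function.update x i) := Function.update_injective x i
    rw [← Finset.sum_subset (Finset.subset_univ (Finset.univ.image (Function.update x i))),
      Finset.sum_image fun a _ b _ h => hinj h]
    · simp only [extend_apply_update, extend_update_apply]
    · intro y _ hy
      rw [extend_apply_eq_zero, zero_mul]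
      rintro b rfl
      exact hy (Finset.mem_image_of_mem _ (Finset.mem_univ b))
  · refine Finset.sum_eq_zero fun y _ => ?_
    by_cases h1 : ∃ b, y = Function.update x i b
    · obtain ⟨b, rfl⟩ := h1
      by_cases hb : b = x i
      · rw [hb, Function.update_eq_self, extend_apply_self, hH, zero_mul]
      · rw [extend_apply_eq_zero (i := j), mul_zero]
        intro c hc
        have := congrFun hc i
        rw [Function.update_of_ne hij, Function.update_self] at this
        exact hb this.symm
    · rw [extend_apply_eq_zero _ _ _ (not_exists.1 h1), zero_mul]

variable [Fintype S] [DecidableEq S] [Fintype ι] [DecidableEq ι]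

/-- Interactions without diagonal blocks do not interfere: the completely positive map of all
baths together is the sum of those of the single baths. -/
theorem interactionMap_sum_extend [∀ i, Fintype (B i)] [∀ i, DecidableEq (B i)]
    (H : ∀ i, Matrix (S × B i) (S × B i) ℂ) (hH : ∀ i s s' b, H i (s, b) (s', b) = 0)
    (w : ∀ i, B i → ℂ) (hw : ∀ i, ∑ b, w i b = 1) :
    interactionMap (∑ i, extend i (H i)) (tensorProd fun i => diagonal (w i)) =
      ∑ i, interactionMap (H i) (diagonal (w i)) := by
  ext1 A
  ext s s'
  rw [LinearMap.sum_apply, Matrix.sum_apply, tensorProd_diagonal, interactionMap_diagonal_apply]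
  simp only [interactionMap_diagonal_apply]
  have h : ∀ x : ∀ i, B i, ((∑ i, extend i (H i)) * (A ⊗ₖ (1 : Matrix (∀ i, B i) (∀ i, B i) ℂ)) *
      ∑ i, extend i (H i)) (s, x) (s', x) =
      ∑ i, (H i * (A ⊗ₖ (1 : Matrix (B i) (B i) ℂ)) * H i) (s, x i) (s', x i) := by
    intro x
    rw [Matrix.sum_mul, Matrix.sum_mul, Matrix.sum_apply]
    refine Finset.sum_congr rfl fun i _ => ?_
    rw [Matrix.mul_sum, Matrix.sum_apply, Finset.sum_eq_single i]
    · rw [mul_kronecker_one_mul_apply, mul_kronecker_one_mul_apply, Finset.sum_comm,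
        Finset.sum_comm (s := (Finset.univ : Finset (B i)))]
      refine Finset.sum_congr rfl fun u _ => ?_
      rw [Finset.sum_comm, Finset.sum_comm (s := (Finset.univ : Finset (B i)))]
      refine Finset.sum_congr rfl fun v _ => ?_
      have := extend_mul_extend_apply (i := i) (j := i) H hH s s' u v x
      rw [if_pos rfl] at this
      simp only [mul_right_comm _ (A u v), ← Finset.sum_mul, this]
    · intro j _ hji
      rw [mul_kronecker_one_mul_apply, Finset.sum_comm]
      refine Finset.sum_eq_zero fun u _ => ?_
      rw [Finset.sum_comm]
      refine Finset.sum_eq_zero fun v _ => ?_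
      have := extend_mul_extend_apply (i := i) (j := j) H hH s s' u v x
      rw [if_neg hji.symm] at this
      simp only [mul_right_comm _ (A u v), ← Finset.sum_mul, this, zero_mul]
    · simp
  simp only [h, Finset.mul_sum]
  rw [Finset.sum_comm]
  exact Finset.sum_congr rfl fun i _ => sum_prod_mul_eq w hw i
    fun b => (H i * (A ⊗ₖ (1 : Matrix (B i) (B i) ℂ)) * H i) (s, b) (s', b)

theorem partialTrace_sum_extend_eq_zero [∀ i, Fintype (B i)] [∀ i, DecidableEq (B i)]
    (H : ∀ i, Matrix (S × B i) (S × B i) ℂ) (hH : ∀ i s s' b, H i (s, b) (s', b) = 0)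
    (w : ∀ i, B i → ℂ) :
    partialTrace ((∑ i, extend i (H i)) *
      ((1 : Matrix S S ℂ) ⊗ₖ tensorProd fun i => diagonal (w i))) = 0 := by
  ext s s'
  refine Finset.sum_eq_zero fun x _ => ?_
  rw [tensorProd_diagonal, ← diagonal_one, diagonal_kronecker_diagonal, mul_diagonal,
    Matrix.sum_apply, Finset.sum_eq_zero, zero_mul]
  intro i _
  rw [extend_apply_self, hH]

/-- The completely positive map of the interaction `c (|p⟩⟨q| + |q⟩⟨p|)`, where `p` and `q` belong
to different levels of the bath. -/
theorem interactionMap_single_add_single {B : Type} [Fintype B] [DecidableEq B] {u v : S}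
    {a b : B} (hab : a ≠ b) (c : ℝ) (w : B → ℝ) :
    interactionMap (single (u, a) (v, b) (c : ℂ) + single (v, b) (u, a) (c : ℂ))
      (diagonal fun x => (w x : ℂ)) =
      jumpMap (single u v (c ^ 2 * w a) + single v u (c ^ 2 * w b)) := by
  ext1 A
  ext s s'
  rw [interactionMap_diagonal_apply, jumpMap_apply]
  -- Of the four products two vanish, since `A ⊗ₖ 1` does not connect the distinct bath levels `a`
  -- and `b`.
  have key : ∀ x, ((single (u, a) (v, b) (c : ℂ) + single (v, b) (u, a) (c : ℂ)) *
      (A ⊗ₖ (1 : Matrix B B ℂ)) * (single (u, a) (v, b) (c : ℂ) + single (v, b) (u, a) (c : ℂ)))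
      (s, x) (s', x) =
      (if u = s ∧ u = s' ∧ a = x then (c : ℂ) ^ 2 * A v v else 0) +
        if v = s ∧ v = s' ∧ b = x then (c : ℂ) ^ 2 * A u u else 0 := by
    intro x
    simp only [Matrix.add_mul, Matrix.mul_add, Matrix.single_mul_mul_single,
      kroneckerMap_apply, Matrix.one_apply_eq, Matrix.one_apply_ne hab,
      Matrix.one_apply_ne hab.symm, mul_zero, zero_mul, mul_one, single_zero, add_zero, zero_add]
    simp only [Matrix.add_apply, single_apply, Prod.mk.injEq]
    rw [add_comm]
    congr 1 <;> refine if_congr ?_ ?_ rfl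
    · tauto
    · ring
    · tauto
    · ring
  simp only [key, mul_add, mul_ite, mul_zero, Finset.sum_add_distrib, Matrix.add_apply,
    single_apply]
  by_cases h : s = s'
  · subst h
    rw [diagonal_apply_eq]
    simp only [Complex.ofReal_add, add_mul, Finset.sum_add_distrib]
    by_cases hu : u = s <;> by_cases hv : v = s <;>
      simp [hu, hv, apply_ite Complex.ofReal, ite_mul] <;> ring
  · have h1 : ∀ (z : S) (q : Prop), ¬(z = s ∧ z = s' ∧ q) := fun z q hz =>
      h (hz.1.symm.trans hz.2.1)
    simp [h, h1]

end Bath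

/-! ### The cycle model: energies, rates and currents -/

section Cycle

theorem lindblad_zero {S : Type} [Fintype S] [DecidableEq S]
    (Φ : Matrix S S ℂ →ₗ[ℂ] Matrix S S ℂ) : lindblad 0 Φ = dissipator Φ := by
  ext1 A
  simp [lindblad]

/-- The weights of the Gibbs state of a Hamiltonian with energy levels `k`. -/
def gibbsWeight {B : Type} [Fintype B] (β : ℝ) (k : B → ℝ) (b : B) : ℝ :=
  (∑ a, Real.exp (-β * k a))⁻¹ * Real.exp (-β * k b)

theorem gibbsWeight_pos {B : Type} [Fintype B] (β : ℝ) (k : B → ℝ) (b : B) :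
    0 < gibbsWeight β k b :=
  mul_pos (inv_pos.2 (Finset.sum_pos (fun _ _ => Real.exp_pos _) ⟨b, Finset.mem_univ b⟩))
    (Real.exp_pos _)

theorem sum_gibbsWeight {B : Type} [Fintype B] [Nonempty B] (β : ℝ) (k : B → ℝ) :
    ∑ b, gibbsWeight β k b = 1 := by
  simp only [gibbsWeight, ← Finset.mul_sum]
  exact inv_mul_cancel₀ (Finset.sum_pos (fun _ _ => Real.exp_pos _) Finset.univ_nonempty).ne'

theorem gibbs_diagonal {B : Type} [Fintype B] [DecidableEq B] (β : ℝ) (k : B → ℝ) :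
    gibbs β (diagonal fun b => (k b : ℂ)) = diagonal fun b => (gibbsWeight β k b : ℂ) := by
  have h : NormedSpace.exp (-(β : ℂ) • diagonal fun b => (k b : ℂ)) =
      diagonal fun b => (Real.exp (-β * k b) : ℂ) := by
    rw [← diagonal_smul, Matrix.exp_diagonal]
    congr 1
    ext b
    rw [Pi.coe_exp, ← Complex.exp_eq_exp_ℂ, Complex.ofReal_exp]
    congr 1
    simp
  rw [gibbs, h, trace_diagonal, ← diagonal_smul]
  congr 1
  ext b
  simp [gibbsWeight]

theorem commute_single_diagonal {I : Type} [Fintype I] [DecidableEq I] {d : I → ℂ} {p q : I}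
    (h : d p = d q) (c : ℂ) : Commute (single p q c) (diagonal d) := by
  ext a b
  rw [mul_diagonal, diagonal_mul, single_apply]
  split_ifs with hab
  · rw [← hab.1, ← hab.2, h, mul_comm]
  · simp

/-- Partial sums starting at level `0` work; only the step from the last level back to `0` needs the
total to vanish. This supplies both the energies and the logarithms of the stationary weights. -/
theorem exists_cyclic_primitive {m : ℕ} (z : Fin (m + 2) → ℝ) (hz : ∑ i, z i = 0) :
    ∃ y : Fin (m + 2) → ℝ, ∀ i, y (i + 1) - y i = z i := by
  refine ⟨fun i => ∑ k ∈ Finset.range i.val, z (Fin.ofNat (m + 2) k), fun i => ?_⟩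
  have hi : ∀ i : Fin (m + 2), Fin.ofNat (m + 2) i.val = i := fun i => by simp
  rcases eq_or_ne i (Fin.last (m + 1)) with rfl | h
  · have h1 : ∑ k ∈ Finset.range (m + 2), z (Fin.ofNat (m + 2) k) = 0 := by
      rw [Finset.sum_range, ← hz]
      exact Finset.sum_congr rfl fun i _ => by rw [hi]
    rw [Finset.sum_range_succ] at h1
    have h2 := hi (Fin.last (m + 1))
    rw [Fin.val_last] at h2
    rw [h2] at h1
    simp only [Fin.last_add_one, Fin.val_zero, Finset.range_zero, Finset.sum_empty, Fin.val_last]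
    linarith
  · simp only [Fin.val_add_one_of_lt (Fin.lt_last_iff_ne_last.2 h), Finset.sum_range_succ, hi]
    ring

theorem exists_pow_apply_pos_of_cycle {m : ℕ} {R : Matrix (Fin (m + 2)) (Fin (m + 2)) ℝ}
    (hR : ∀ s t, 0 ≤ R s t) (hcyc : ∀ s, 0 < R s (s + 1)) (s t : Fin (m + 2)) :
    ∃ k, 0 < k ∧ 0 < (R ^ k) s t := by
  have h : ∀ (k : ℕ) (s : Fin (m + 2)), 0 < (R ^ k) s (s + Fin.ofNat (m + 2) k) := by
    intro k
    induction k with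
    | zero => intro s; simp
    | succ k ih =>
      intro s
      rw [pow_succ', Matrix.mul_apply]
      refine Finset.sum_pos' (fun u _ => mul_nonneg (hR s u) (pow_apply_nonneg hR k u _))
        ⟨s + 1, Finset.mem_univ _, mul_pos (hcyc s) ?_⟩
      have h1 : s + Fin.ofNat (m + 2) (k + 1) = s + 1 + Fin.ofNat (m + 2) k := by
        ext
        simp [Fin.val_add]
        congr 1
        ring
      rw [h1]
      exact ih (s + 1)
  -- An extra full turn keeps the path length positive even when `s = t`.
  refine ⟨(t - s).val + (m + 2), by omega, ?_⟩
  have h2 : s + Fin.ofNat (m + 2) ((t - s).val + (m + 2)) = t := by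
    have h3 : Fin.ofNat (m + 2) ((t - s).val + (m + 2)) = t - s := by
      ext
      simp [Nat.mod_eq_of_lt (t - s).isLt]
    rw [h3, add_sub_cancel]
  have h4 := h ((t - s).val + (m + 2)) s
  rwa [h2] at h4

variable {m : ℕ} {β J e : Fin (m + 2) → ℝ}

/-- The interaction that lets the system pass between the levels `i` and `i + 1` of a cycle while
a two-level bath is flipped. -/
def cycleInteraction (c : Fin (m + 2) → ℝ) (i : Fin (m + 2)) :
    Matrix (Fin (m + 2) × Fin 2) (Fin (m + 2) × Fin 2) ℂ :=
  single (i + 1, 1) (i, 0) (c i : ℂ) + single (i, 0) (i + 1, 1) (c i : ℂ)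

theorem cycleInteraction_zero_diagonal (c : Fin (m + 2) → ℝ) (i s s' : Fin (m + 2)) (b : Fin 2) :
    cycleInteraction c i (s, b) (s', b) = 0 := by
  fin_cases b <;> simp [cycleInteraction]

/-- The system moves on a cycle of levels with energies `e`; the step between the levels `i` and
`i + 1` is driven by the `i`-th bath, a two-level system that takes up the energy
`J i = e i - e (i + 1)`. -/
def cycleModel (β J e c : Fin (m + 2) → ℝ) (he : ∀ i, e (i + 1) - e i = -J i) :
    ThermalModel β where
  S := Fin (m + 2)
  B := fun _ => Fin 2
  fintypeS := inferInstance
  decEqS := inferInstance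
  nonemptyS := inferInstance
  fintypeB := fun _ => inferInstance
  decEqB := fun _ => inferInstance
  nonemptyB := fun _ => inferInstance
  HS := 0
  KS := diagonal fun s => (e s : ℂ)
  KB := fun i => diagonal fun b => ((![0, J i] b : ℝ) : ℂ)
  HSB := cycleInteraction c
  HS_herm := isHermitian_zero
  KS_herm := isHermitian_diagonal_of_self_adjoint _ (by ext; simp)
  KB_herm := fun i => isHermitian_diagonal_of_self_adjoint _ (by ext; simp)
  HSB_herm := fun i => by
    rw [IsHermitian, cycleInteraction, conjTranspose_add, conjTranspose_single,
      conjTranspose_single, RCLike.star_def, Complex.conj_ofReal]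
    exact add_comm _ _
  HS_comm := Commute.zero_left _
  HSB_comm := fun i => by
    rw [← diagonal_one, ← diagonal_one, cycleInteraction, diagonal_kronecker_diagonal,
      diagonal_kronecker_diagonal,
      diagonal_add]
    -- The two states that the interaction connects have the same total energy.
    have h : (e (i + 1) : ℂ) + J i = e i := by
      have := he i
      rw [← Complex.ofReal_add, Complex.ofReal_inj]
      linarith
    exact (commute_single_diagonal (by simp [h]) _).add_left
      (commute_single_diagonal (by simp [h]) _)
  centered := by
    simp only [gibbs_diagonal]
    exact partialTrace_sum_extend_eq_zero (B := fun _ : Fin (m + 2) => Fin 2) (cycleInteraction c)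
      (cycleInteraction_zero_diagonal c) fun i b => (gibbsWeight (β i) ![0, J i] b : ℂ)

/-- The transition rates due to the `i`-th bath. -/
def cycleRate (β J c : Fin (m + 2) → ℝ) (i : Fin (m + 2)) :
    Matrix (Fin (m + 2)) (Fin (m + 2)) ℝ :=
  single (i + 1) i (c i ^ 2 * gibbsWeight (β i) ![0, J i] 1) +
    single i (i + 1) (c i ^ 2 * gibbsWeight (β i) ![0, J i] 0)

theorem interactionMap_cycleInteraction (c : Fin (m + 2) → ℝ) (i : Fin (m + 2)) :
    interactionMap (cycleInteraction c i)
      (diagonal fun b => (gibbsWeight (β i) ![0, J i] b : ℂ)) = jumpMap (cycleRate β J c i) := by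
  rw [cycleInteraction, cycleRate]
  exact interactionMap_single_add_single one_ne_zero (c i) (gibbsWeight (β i) ![0, J i])

theorem cycleModel_bathState (c : Fin (m + 2) → ℝ) (he : ∀ i, e (i + 1) - e i = -J i)
    (i : Fin (m + 2)) : (cycleModel β J e c he).bathState i =
      diagonal fun b => (gibbsWeight (β i) ![0, J i] b : ℂ) :=
  gibbs_diagonal (β i) ![0, J i]

theorem cycleModel_hasZeroDiagonal (c : Fin (m + 2) → ℝ) (he : ∀ i, e (i + 1) - e i = -J i) :
    (cycleModel β J e c he).HasZeroDiagonal := by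
  refine fun i => ⟨1, one_mem _, ?_, fun j s s' => ?_⟩
  · rw [conjTranspose_one, Matrix.one_mul, Matrix.mul_one]
    exact isDiag_diagonal _
  · rw [conjTranspose_one, one_kronecker_one, Matrix.one_mul, Matrix.mul_one]
    exact cycleInteraction_zero_diagonal c i s s' j

theorem cycleModel_bathLindbladian (c : Fin (m + 2) → ℝ) (he : ∀ i, e (i + 1) - e i = -J i)
    (i : Fin (m + 2)) : (cycleModel β J e c he).bathLindbladian i =
      dissipator (jumpMap (cycleRate β J c i)) := by
  rw [ThermalModel.bathLindbladian, cycleModel_bathState]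
  exact congrArg dissipator (interactionMap_cycleInteraction c i)

theorem cycleModel_lindbladian (c : Fin (m + 2) → ℝ) (he : ∀ i, e (i + 1) - e i = -J i) :
    (cycleModel β J e c he).lindbladian =
      dissipator (jumpMap (∑ i, cycleRate β J c i)) := by
  have h : (cycleModel β J e c he).lindbladian =
      dissipator (interactionMap (cycleModel β J e c he).fullInteraction
        (cycleModel β J e c he).fullBathState) := lindblad_zero _
  rw [h, ← jumpMap_sum]
  congr 1
  rw [ThermalModel.fullBathState, funext (cycleModel_bathState c he)]
  refine (interactionMap_sum_extend (B := fun _ : Fin (m + 2) => Fin 2) (cycleInteraction c)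
    (cycleInteraction_zero_diagonal c) (fun i b => (gibbsWeight (β i) ![0, J i] b : ℂ)) ?_).trans ?_
  · exact fun i => by exact_mod_cast sum_gibbsWeight (β i) ![0, J i]
  · exact Finset.sum_congr rfl fun i _ => interactionMap_cycleInteraction c i

theorem cycleRate_nonneg (c : Fin (m + 2) → ℝ) (i s t : Fin (m + 2)) :
    0 ≤ cycleRate β J c i s t := by
  have h : ∀ b, 0 ≤ c i ^ 2 * gibbsWeight (β i) ![0, J i] b := fun b =>
    mul_nonneg (sq_nonneg _) (gibbsWeight_pos _ _ _).le
  rw [cycleRate, Matrix.add_apply, single_apply, single_apply]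
  refine add_nonneg ?_ ?_ <;> split_ifs <;> first | exact h _ | exact le_rfl

theorem sum_cycleRate_apply_succ_pos {c : Fin (m + 2) → ℝ} (hc : ∀ i, c i ≠ 0)
    (s : Fin (m + 2)) : 0 < (∑ i, cycleRate β J c i) s (s + 1) := by
  rw [Matrix.sum_apply]
  refine Finset.sum_pos' (fun i _ => cycleRate_nonneg c i _ _) ⟨s, Finset.mem_univ s, ?_⟩
  rw [cycleRate, Matrix.add_apply, single_apply_same]
  refine add_pos_of_nonneg_of_pos ?_ (mul_pos (sq_pos_of_ne_zero (hc s)) (gibbsWeight_pos _ _ _))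
  rw [single_apply, if_neg]
  simp

/-- A constant current along the cycle makes `p` stationary. -/
theorem cycleRate_stationary {c p : Fin (m + 2) → ℝ}
    (hcur : ∀ i, c i ^ 2 * (p i * gibbsWeight (β i) ![0, J i] 0 -
      p (i + 1) * gibbsWeight (β i) ![0, J i] 1) = 1) (t : Fin (m + 2)) :
    ∑ s, p s * (∑ i, cycleRate β J c i) s t = p t * ∑ s, (∑ i, cycleRate β J c i) t s := by
  -- The net inflow at `t` due to bath `i` alone: a unit current leaves `i` and enters `i + 1`.
  -- Summed over the cycle, these contributions cancel.
  have hi : ∀ i, ∑ s, p s * cycleRate β J c i s t - p t * ∑ s, cycleRate β J c i t s =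
      (if i + 1 = t then 1 else 0) - if i = t then 1 else 0 := by
    intro i
    simp only [cycleRate, Matrix.add_apply, single_apply, mul_add, Finset.sum_add_distrib,
      ite_and, mul_ite, mul_zero, Finset.sum_ite_eq, Finset.mem_univ, if_true,
      Finset.sum_ite_irrel, Finset.sum_const_zero]
    have hp1 : i + 1 = t → p t = p (i + 1) := fun h => h ▸ rfl
    have hp2 : i = t → p t = p i := fun h => h ▸ rfl
    split_ifs with h1 h2 h2
    · linear_combination -(c i ^ 2 * gibbsWeight (β i) ![0, J i] 0) * hp2 h1 -
        c i ^ 2 * gibbsWeight (β i) ![0, J i] 1 * hp1 h2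
    · linear_combination -hcur i - c i ^ 2 * gibbsWeight (β i) ![0, J i] 0 * hp2 h1
    · linear_combination hcur i - c i ^ 2 * gibbsWeight (β i) ![0, J i] 1 * hp1 h2
    · ring
  have hsum : ∑ i : Fin (m + 2), (if i + 1 = t then (1 : ℝ) else 0) = 1 := by
    refine (Equiv.sum_comp (Equiv.addRight (1 : Fin (m + 2)))
      fun i => if i = t then (1 : ℝ) else 0).trans ?_
    simp
  have htot := Finset.sum_congr (s₁ := Finset.univ) rfl fun i _ => hi i
  rw [Finset.sum_sub_distrib, Finset.sum_sub_distrib, hsum] at htot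
  simp only [Matrix.sum_apply, Finset.mul_sum]
  rw [Finset.sum_comm, Finset.sum_comm (f := fun s i => p t * cycleRate β J c i t s),
    ← sub_eq_zero]
  simpa [Finset.mul_sum] using htot

/-- Bath `i` drives only the step from `i` to `i + 1`, which costs the system the energy `J i` and
carries unit net current. -/
theorem cycleModel_flux {c p : Fin (m + 2) → ℝ} (he : ∀ i, e (i + 1) - e i = -J i)
    (hcur : ∀ i, c i ^ 2 * (p i * gibbsWeight (β i) ![0, J i] 0 -
      p (i + 1) * gibbsWeight (β i) ![0, J i] 1) = 1) (i : Fin (m + 2)) :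
    (cycleModel β J e c he).flux i (diagonal fun s : Fin (m + 2) => (p s : ℂ)) = (J i : ℂ) := by
  have h : (cycleModel β J e c he).flux i (diagonal fun s : Fin (m + 2) => (p s : ℂ)) =
      -((diagonal fun s : Fin (m + 2) => (p s : ℂ)) *
        dissipator (jumpMap (cycleRate β J c i)) (diagonal fun s => (e s : ℂ))).trace := by
    rw [ThermalModel.flux, cycleModel_bathLindbladian]
    rfl
  rw [h, trace_diagonal_mul_dissipator_jumpMap]
  have h2 : ∑ s, p s * ∑ t, cycleRate β J c i s t * (e t - e s) = -J i := by
    simp only [cycleRate, Matrix.add_apply, single_apply, add_mul, Finset.sum_add_distrib, mul_add,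
      ite_and, ite_mul, zero_mul, Finset.sum_ite_eq, Finset.mem_univ, if_true, mul_ite, mul_zero,
      Finset.sum_ite_irrel, Finset.sum_const_zero]
    linear_combination (c i ^ 2 * (p i * gibbsWeight (β i) ![0, J i] 0 -
      p (i + 1) * gibbsWeight (β i) ![0, J i] 1)) * he i - J i * hcur i
  simp only [diagonal_apply_eq]
  rw [neg_eq_iff_eq_neg]
  exact_mod_cast h2

/-- For a positive total affinity the couplings can be chosen such that some positive
distribution carries a unit current along the cycle. -/
theorem exists_unit_current (β J : Fin (m + 2) → ℝ) (hβJ : 0 < ∑ i, β i * J i) :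
    ∃ c p : Fin (m + 2) → ℝ, (∀ i, c i ≠ 0) ∧ (∀ i, 0 < p i) ∧ ∑ i, p i = 1 ∧
      ∀ i, c i ^ 2 * (p i * gibbsWeight (β i) ![0, J i] 0 -
        p (i + 1) * gibbsWeight (β i) ![0, J i] 1) = 1 := by
  -- The affinity per edge. With `p` proportional to `exp (-y)`, the log ratio of forward to
  -- backward flow on edge `i` is `y (i + 1) - y i + β i * J i`; requiring it to be `a` on every
  -- edge is consistent because the increments of `y` then sum to zero.
  set a : ℝ := (∑ i, β i * J i) / (m + 2) with ha
  have hapos : 0 < a := by positivity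
  obtain ⟨y, hy⟩ := exists_cyclic_primitive (fun i => a - β i * J i) (by
    rw [Finset.sum_sub_distrib, Finset.sum_const, Finset.card_univ, Fintype.card_fin, ha,
      nsmul_eq_mul]
    push_cast
    field_simp
    ring)
  set N : ℝ := ∑ i, Real.exp (-y i) with hN
  have hNpos : 0 < N := Finset.sum_pos (fun _ _ => Real.exp_pos _) Finset.univ_nonempty
  set p : Fin (m + 2) → ℝ := fun i => Real.exp (-y i) / N with hp
  set d : Fin (m + 2) → ℝ := fun i => p i * gibbsWeight (β i) ![0, J i] 0 -
    p (i + 1) * gibbsWeight (β i) ![0, J i] 1 with hd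
  have hdpos : ∀ i, 0 < d i := by
    intro i
    have h1 : d i = (Real.exp (-y i) - Real.exp (-y (i + 1)) * Real.exp (-β i * J i)) / N *
        (∑ b, Real.exp (-β i * ![0, J i] b))⁻¹ := by
      simp only [hd, hp, gibbsWeight, Matrix.cons_val_zero, Matrix.cons_val_one, mul_zero,
        Real.exp_zero]
      ring
    have h2 : 0 < ∑ b, Real.exp (-β i * ![0, J i] b) :=
      Finset.sum_pos (fun _ _ => Real.exp_pos _) Finset.univ_nonempty
    rw [h1, ← Real.exp_add]
    refine mul_pos (div_pos (sub_pos.2 (Real.exp_lt_exp.2 ?_)) hNpos) (inv_pos.2 h2)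
    linarith [hy i]
  -- Rates scale with `c i ^ 2`, so this coupling rescales the positive current `d i` to one.
  refine ⟨fun i => (Real.sqrt (d i))⁻¹, p, fun i => inv_ne_zero (Real.sqrt_pos.2 (hdpos i)).ne',
    fun i => div_pos (Real.exp_pos _) hNpos, ?_, fun i => ?_⟩
  · rw [hp, ← Finset.sum_div, div_self hNpos.ne']
  · rw [inv_pow, Real.sq_sqrt (hdpos i).le]
    exact inv_mul_cancel₀ (hdpos i).ne'

end Cycle

end

end QuantumThermal

theorem mainTheorem3 (n : ℕ) (β J : Fin n → ℝ)
    (hJ : ∑ i, J i = 0) (hβJ : 0 < ∑ i, β i * J i) :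
    ∃ M : QuantumThermal.ThermalModel β,
      M.HasZeroDiagonal ∧
      QuantumThermal.IsPositivityImproving M.lindbladian ∧
      QuantumThermal.IsPrimitive M.lindbladian ∧
      ∃ ρ : Matrix M.S M.S ℂ,
        QuantumThermal.IsStationaryState M.lindbladian ρ ∧
        ρ.PosDef ∧
        (∀ ρ' : Matrix M.S M.S ℂ,
          QuantumThermal.IsStationaryState M.lindbladian ρ' → ρ' = ρ) ∧
        ∀ i, M.flux i ρ = (J i : ℂ) := by
  open QuantumThermal in
  match n, β, J, hJ, hβJ with
  -- With fewer than two baths the hypotheses are contradictory: `∑ i, J i = 0` leaves no room for a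
  -- positive affinity.
  | 0, _, _, _, hβJ => exact absurd hβJ (by simp)
  | 1, _, J, hJ, hβJ =>
    have h0 : J 0 = 0 := by simpa using hJ
    exact absurd hβJ (by simp [h0])
  | m + 2, β, J, hJ, hβJ =>
    obtain ⟨e, he⟩ := exists_cyclic_primitive (fun i => -J i) (by simp [hJ])
    obtain ⟨c, p, hc, hp0, hp1, hcur⟩ := exists_unit_current β J hβJ
    have hR : ∀ s t, 0 ≤ (∑ i, cycleRate β J c i) s t := fun s t => by
      rw [Matrix.sum_apply]
      exact Finset.sum_nonneg fun i _ => cycleRate_nonneg c i s t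
    have hirr := exists_pow_apply_pos_of_cycle hR (sum_cycleRate_apply_succ_pos hc)
    have hst := cycleRate_stationary hcur
    refine ⟨cycleModel β J e c he, cycleModel_hasZeroDiagonal c he, ?_⟩
    rw [cycleModel_lindbladian]
    exact ⟨isPositivityImproving_jumpMap hR hirr, isPrimitive_jumpMap hR hirr hp0 hst,
      Matrix.diagonal fun s : Fin (m + 2) => (p s : ℂ), isStationaryState_diagonal hp0 hp1 hst,
      Matrix.PosDef.diagonal fun s => Complex.zero_lt_real.2 (hp0 s),
      fun ρ' hρ' => hρ'.eq_diagonal hR hirr hp0 hp1 hst, cycleModel_flux he hcur⟩
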